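/- Let $p$ be a prime, let $\mathbf{C}_p$ be the completion of an algebraic closure of $\mathbf{Q}_p$, and let $\theta : \mathbf{B}_{\mathrm{dR}}^+ \to \mathbf{C}_p$ be Fontaine's map. Equip $\mathbf{B}_{\mathrm{dR}}^+ = \varprojlim_k \mathbf{B}_{\mathrm{dR}}^+/(\ker\theta)^k$ with its canonical topology, the inverse limit of the topologies of the $p$-adic Banach spaces $\mathbf{B}_{\mathrm{dR}}^+/(\ker\theta)^k$, whose unit ball is the image of $\mathbf{A}_{\mathrm{inf}} = W(\varprojlim_{x \mapsto x^p} \mathcal{O}_{\mathbf{C}_p}/p)$. Let $E$ be a finite extension of $\mathbf{Q}_p$ with a $\mathbf{Q}_p$-embedding $\sigma : E \to \mathbf{C}_p$, and view $E$ as a subfield of $\mathbf{B}_{\mathrm{dR}}^+$ through the unique $\mathbf{Q}_p$-algebra homomorphism $\iota : E \to \mathbf{B}_{\mathrm{dR}}^+$ such that $\theta \circ \iota = \sigma$. Let $f(T) = \sum_{n \geq 0} a_n T^n \in E[[T]]$ and $x \in \mathbf{B}_{\mathrm{dR}}^+$. Then the series $f(x) = \sum_{n \geq 0} \iota(a_n)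 x^n$ converges in $\mathbf{B}_{\mathrm{dR}}^+$ if and only if the series $f(\theta(x)) = \sum_{n \geq 0} \sigma(a_n) \theta(x)^n$ converges in $\mathbf{C}_p$. -/

import Mathlib

noncomputable section

namespace PadicComplexInt
variable (p : ℕ) [Fact p.Prime]

theorem norm_le_one_iff (x : ℂ_[p]) : x ∈ 𝓞_ℂ_[p] ↔ ‖x‖ ≤ 1 := by
  rw [PadicComplex.norm_eq_norm, Valuation.norm_def]
  change Valued.v x ≤ 1 ↔ _
  simp

theorem norm_p : ‖(p : ℂ_[p])‖ = (p : ℝ)⁻¹ := by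
  have := PadicComplex.norm_extends' p (p : ℚ_[p])
  simpa using this

theorem norm_le_iff_dvd (n : ℕ) (x : 𝓞_ℂ_[p]) :
    (p : 𝓞_ℂ_[p]) ^ n ∣ x ↔ ‖(x : ℂ_[p])‖ ≤ ((p : ℝ)⁻¹) ^ n := by
  have hp0 : (p : ℂ_[p]) ≠ 0 := Nat.cast_ne_zero.2 (Fact.out : p.Prime).ne_zero
  have hpos : 0 < ((p : ℝ)⁻¹) ^ n := by
    have := (Fact.out : p.Prime).pos
    positivity
  constructor
  · rintro ⟨y, rfl⟩
    have hy := (norm_le_one_iff p y).1 y.2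
    push_cast
    rw [norm_mul, norm_pow, norm_p]
    exact mul_le_of_le_one_right hpos.le hy
  · intro h
    refine ⟨⟨(x : ℂ_[p]) / (p : ℂ_[p]) ^ n, ?_⟩, ?_⟩
    · rw [norm_le_one_iff, norm_div, norm_pow, norm_p]
      exact div_le_one_of_le₀ h hpos.le
    · apply Subtype.ext
      push_cast
      field_simp

instance fact_not_isUnit : Fact (¬ IsUnit (p : 𝓞_ℂ_[p])) := ⟨fun h ↦ by
  have h1 : (p : 𝓞_ℂ_[p]) ^ 1 ∣ 1 := by simpa using h.dvd
  rw [norm_le_iff_dvd] at h1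
  have : (1 : ℝ) < p := by exact_mod_cast (Fact.out : p.Prime).one_lt
  have := inv_lt_one_of_one_lt₀ this
  simp at h1
  linarith⟩

theorem sub_mem_iff (n : ℕ) (x y : 𝓞_ℂ_[p]) :
    x ≡ y [SMOD (Ideal.span {(p : 𝓞_ℂ_[p])} ^ n • ⊤ : Submodule 𝓞_ℂ_[p] 𝓞_ℂ_[p])] ↔
      ‖(x : ℂ_[p]) - y‖ ≤ ((p : ℝ)⁻¹) ^ n := by
  rw [SModEq.sub_mem, smul_eq_mul, Ideal.mul_top, Ideal.span_singleton_pow,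
    Ideal.mem_span_singleton, norm_le_iff_dvd]
  rfl

theorem tendsto_inv_pow : Filter.Tendsto (fun n : ℕ ↦ ((p : ℝ)⁻¹) ^ n) Filter.atTop (nhds 0) := by
  apply tendsto_pow_atTop_nhds_zero_of_lt_one (by positivity)
  exact inv_lt_one_of_one_lt₀ (by exact_mod_cast (Fact.out : p.Prime).one_lt)

instance isAdicComplete : IsAdicComplete (Ideal.span {(p : 𝓞_ℂ_[p])}) 𝓞_ℂ_[p] where
  haus' x hx := by
    simp only [sub_mem_iff] at hx
    apply Subtype.ext
    have := ge_of_tendsto' (tendsto_inv_pow p) hx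
    simpa using this
  prec' f hf := by
    simp only [sub_mem_iff] at hf ⊢
    have hc : CauchySeq (fun n ↦ (f n : ℂ_[p])) :=
      cauchySeq_of_le_tendsto_0 (fun n ↦ ((p : ℝ)⁻¹) ^ n)
        (fun n m N hn hm ↦ by
          rw [dist_eq_norm]
          have h1 := hf hn
          have h2 := hf hm
          calc ‖(f n : ℂ_[p]) - f m‖ = ‖((f N : ℂ_[p]) - f m) - (f N - f n)‖ := by congr 1; ring
            _ ≤ max ‖(f N : ℂ_[p]) - f m‖ ‖(f N : ℂ_[p]) - f n‖ :=
              by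
                rw [sub_eq_add_neg, ← norm_neg ((f N : ℂ_[p]) - f n)]
                exact IsUltrametricDist.norm_add_le_max _ _
            _ ≤ _ := max_le h2 h1)
        (tendsto_inv_pow p)
    obtain ⟨L, hL⟩ := cauchySeq_tendsto_of_complete hc
    refine ⟨⟨L, (norm_le_one_iff p L).2
      (le_of_tendsto' hL.norm fun n ↦ (norm_le_one_iff p _).1 (f n).2)⟩, fun n ↦ ?_⟩
    refine le_of_tendsto (hL.const_sub (f n : ℂ_[p])).norm ?_
    filter_upwards [Filter.eventually_ge_atTop n] with m hm using hf hm

theorem frobenius_surjective : Function.Surjective (frobenius (ModP 𝓞_ℂ_[p] p) p) := by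
  intro x
  obtain ⟨x, rfl⟩ := Ideal.Quotient.mk_surjective x
  obtain ⟨y, hy⟩ := IsAlgClosed.exists_pow_nat_eq (x : ℂ_[p]) (Fact.out : p.Prime).pos
  have hy1 : ‖y‖ ≤ 1 := by
    have := (norm_le_one_iff p _).1 x.2
    rw [← hy, norm_pow] at this
    exact (pow_le_one_iff_of_nonneg (norm_nonneg _) (Fact.out : p.Prime).ne_zero).1 this
  refine ⟨Ideal.Quotient.mk _ ⟨y, (norm_le_one_iff p y).2 hy1⟩, ?_⟩
  rw [frobenius_def, ← map_pow]
  congr 1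
  exact Subtype.ext hy

end PadicComplexInt

namespace BdRPlus
open Filter Topology
variable (p : ℕ) [Fact p.Prime]

/-- `A_inf = W(𝓞♭)` where `𝓞♭ = lim_{x ↦ x ^ p} 𝓞 / p` and `𝓞` is the ring of integers of `ℂ_p`. -/
abbrev Ainf : Type := WittVector p (PreTilt 𝓞_ℂ_[p] p)

/-- `A_inf[1/p]`. -/
abbrev Binf : Type := Localization.Away (p : Ainf p)

/-- The kernel of the map `θ : A_inf[1/p] → 𝓞[1/p] = ℂ_p`. -/
abbrev kerTheta : Ideal (Binf p) := RingHom.ker (fontaineThetaInvertP 𝓞_ℂ_[p] p)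

theorem isUnit_p_complex : IsUnit (algebraMap 𝓞_ℂ_[p] ℂ_[p] (p : 𝓞_ℂ_[p])) := by
  rw [map_natCast]
  exact (Nat.cast_ne_zero.2 (Fact.out : p.Prime).ne_zero).isUnit

/-- The identification `𝓞[1/p] = ℂ_p`. -/
def invertPToComplex : Localization.Away (p : 𝓞_ℂ_[p]) →+* ℂ_[p] :=
  IsLocalization.Away.lift (p : 𝓞_ℂ_[p]) (isUnit_p_complex p)

theorem invertPToComplex_injective : Function.Injective (invertPToComplex p) := by
  rw [injective_iff_map_eq_zero]
  intro x hx
  obtain ⟨n, a, ha⟩ := IsLocalization.Away.surj (p : 𝓞_ℂ_[p]) x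
  have h := congrArg (invertPToComplex p) ha
  rw [map_mul, hx, zero_mul, invertPToComplex, IsLocalization.Away.lift_eq] at h
  have ha0 : a = 0 := Subtype.ext h.symm
  rw [ha0, map_zero] at ha
  exact ((IsLocalization.Away.algebraMap_isUnit (p : 𝓞_ℂ_[p])).pow n).mul_left_eq_zero.1 ha

theorem fontaineThetaInvertP_algebraMap (a : Ainf p) :
    fontaineThetaInvertP 𝓞_ℂ_[p] p (algebraMap _ (Binf p) a) =
      algebraMap _ _ (WittVector.fontaineTheta 𝓞_ℂ_[p] p a) := by
  simp [fontaineThetaInvertP, Localization.awayLift, IsLocalization.Away.lift_eq]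

/-- The map `θ : A_inf[1/p] → ℂ_p` as a ring homomorphism. -/
def thetaBinfHom : Binf p →+* ℂ_[p] := (invertPToComplex p).comp (fontaineThetaInvertP 𝓞_ℂ_[p] p)

theorem thetaBinfHom_algebraMap (a : Ainf p) :
    thetaBinfHom p (algebraMap _ (Binf p) a) = (WittVector.fontaineTheta 𝓞_ℂ_[p] p a : ℂ_[p]) := by
  rw [thetaBinfHom, RingHom.comp_apply, fontaineThetaInvertP_algebraMap, invertPToComplex,
    IsLocalization.Away.lift_eq]
  rfl

theorem thetaBinfHom_surjective : Function.Surjective (thetaBinfHom p) := by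
  intro c
  obtain ⟨n, hn⟩ : ∃ n : ℕ, (p : ℂ_[p]) ^ n * c ∈ 𝓞_ℂ_[p] := by
    have h := (PadicComplexInt.tendsto_inv_pow p).mul_const ‖c‖
    rw [zero_mul] at h
    obtain ⟨n, hn⟩ := (h.eventually (gt_mem_nhds one_pos)).exists
    refine ⟨n, (PadicComplexInt.norm_le_one_iff p _).2 ?_⟩
    rw [norm_mul, norm_pow, PadicComplexInt.norm_p]
    exact hn.le
  obtain ⟨a, ha⟩ := surjective_fontaineTheta (R := 𝓞_ℂ_[p]) (p := p)
    (PadicComplexInt.frobenius_surjective p) ⟨_, hn⟩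
  refine ⟨IsLocalization.mk' (Binf p) a
    (⟨(p : Ainf p) ^ n, n, rfl⟩ : Submonoid.powers (p : Ainf p)), ?_⟩
  have hp0 : (p : ℂ_[p]) ^ n ≠ 0 := pow_ne_zero _ (Nat.cast_ne_zero.2 (Fact.out : p.Prime).ne_zero)
  apply mul_left_cancel₀ hp0
  have h := congrArg (thetaBinfHom p) (IsLocalization.mk'_spec' (Binf p) a
    (⟨(p : Ainf p) ^ n, n, rfl⟩ : Submonoid.powers (p : Ainf p)))
  rw [map_mul, thetaBinfHom_algebraMap, thetaBinfHom_algebraMap, ha] at h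
  simpa using h

/-- The map `ℤ_p = W(𝔽_p) → W(𝓞♭) = A_inf`. -/
def padicIntToAinf : ℤ_[p] →+* Ainf p :=
  (WittVector.map (ZMod.castHom (dvd_refl p) (PreTilt 𝓞_ℂ_[p] p))).comp
    (WittVector.equiv p).symm.toRingHom

theorem isUnit_padicInt (y : nonZeroDivisors ℤ_[p]) :
    IsUnit (((algebraMap (Ainf p) (Binf p)).comp (padicIntToAinf p)) y) := by
  rw [PadicInt.unitCoeff_spec (nonZeroDivisors.coe_ne_zero y), map_mul, map_pow, map_natCast]
  refine ((PadicInt.unitCoeff _).isUnit.map _).mul (IsUnit.pow _ ?_)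
  have := IsLocalization.Away.algebraMap_isUnit (S := Binf p) (p : Ainf p)
  rwa [map_natCast] at this

/-- `A_inf[1/p]` is an algebra over `ℚ_p = W(𝔽_p)[1/p]`. -/
instance algebraBinf : Algebra ℚ_[p] (Binf p) :=
  (IsLocalization.lift (isUnit_padicInt p) : ℚ_[p] →+* Binf p).toAlgebra

theorem algebraMap_binf (x : ℤ_[p]) :
    algebraMap ℚ_[p] (Binf p) x = algebraMap (Ainf p) (Binf p) (padicIntToAinf p x) :=
  IsLocalization.lift_eq (isUnit_padicInt p) x

theorem fontaineTheta_padicInt (x : ℤ_[p]) :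
    (WittVector.fontaineTheta 𝓞_ℂ_[p] p (padicIntToAinf p x) : ℂ_[p]) =
      algebraMap ℚ_[p] ℂ_[p] x := by
  have hle : ∀ n : ℕ, ‖(WittVector.fontaineTheta 𝓞_ℂ_[p] p (padicIntToAinf p x) : ℂ_[p]) -
      algebraMap ℚ_[p] ℂ_[p] x‖ ≤ ((p : ℝ)⁻¹) ^ n := by
    intro n
    obtain ⟨y, hy⟩ := Ideal.mem_span_singleton.1 (PadicInt.appr_spec n x)
    have hx : x = (PadicInt.appr x n : ℤ_[p]) + (p : ℤ_[p]) ^ n * y := by rw [← hy]; ring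
    have h1 := (PadicComplexInt.norm_le_one_iff p _).1
      (WittVector.fontaineTheta 𝓞_ℂ_[p] p (padicIntToAinf p y)).2
    have h2 : ‖algebraMap ℚ_[p] ℂ_[p] y‖ ≤ 1 := by
      rw [norm_algebraMap']
      exact y.2
    generalize PadicInt.appr x n = m at hx
    have key : (WittVector.fontaineTheta 𝓞_ℂ_[p] p (padicIntToAinf p x) : ℂ_[p]) -
        algebraMap ℚ_[p] ℂ_[p] x = (p : ℂ_[p]) ^ n *
          ((WittVector.fontaineTheta 𝓞_ℂ_[p] p (padicIntToAinf p y) : ℂ_[p]) -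
            algebraMap ℚ_[p] ℂ_[p] y) := by
      rw [hx]
      push_cast
      simp only [map_add, map_mul, map_pow, map_natCast]
      push_cast
      ring
    rw [key, norm_mul, norm_pow, PadicComplexInt.norm_p]
    refine mul_le_of_le_one_right (by positivity) ?_
    rw [sub_eq_add_neg]
    refine (IsUltrametricDist.norm_add_le_max _ _).trans (max_le h1 ?_)
    rwa [norm_neg]
  have := ge_of_tendsto' (PadicComplexInt.tendsto_inv_pow p) hle
  exact sub_eq_zero.1 (norm_le_zero_iff.1 this)

/-- The map `θ : A_inf[1/p] → ℂ_p` as a homomorphism of `ℚ_p`-algebras. -/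
def thetaBinf : Binf p →ₐ[ℚ_[p]] ℂ_[p] where
  __ := thetaBinfHom p
  commutes' r := by
    have h : (thetaBinfHom p).comp (algebraMap ℚ_[p] (Binf p)) = algebraMap ℚ_[p] ℂ_[p] := by
      apply IsLocalization.ringHom_ext (nonZeroDivisors ℤ_[p])
      ext x
      change thetaBinfHom p (algebraMap ℚ_[p] (Binf p) x) = algebraMap ℚ_[p] ℂ_[p] x
      rw [algebraMap_binf, thetaBinfHom_algebraMap, fontaineTheta_padicInt]
    exact RingHom.congr_fun h r

theorem thetaBinf_eq_zero_iff (b : Binf p) : thetaBinf p b = 0 ↔ b ∈ kerTheta p := by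
  change invertPToComplex p (fontaineThetaInvertP 𝓞_ℂ_[p] p b) = 0 ↔ _
  rw [map_eq_zero_iff _ (invertPToComplex_injective p), RingHom.mem_ker]

/-- The isomorphism `A_inf[1/p] / ker θ ≃ ℂ_p` induced by `θ`. -/
def residueEquiv : (Binf p ⧸ kerTheta p) ≃ₐ[ℚ_[p]] ℂ_[p] :=
  AlgEquiv.ofBijective
    (Ideal.Quotient.liftₐ (kerTheta p) (thetaBinf p) fun b hb ↦ (thetaBinf_eq_zero_iff p b).2 hb) <| by
    constructor
    · rw [injective_iff_map_eq_zero]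
      intro x hx
      obtain ⟨b, rfl⟩ := Ideal.Quotient.mk_surjective x
      exact Ideal.Quotient.eq_zero_iff_mem.2 ((thetaBinf_eq_zero_iff p b).1 hx)
    · intro c
      obtain ⟨b, hb⟩ := thetaBinfHom_surjective p c
      exact ⟨Ideal.Quotient.mk _ b, hb⟩

end BdRPlus

/-- Fontaine's ring `B_dR^+`: the completion of `A_inf[1/p]` along the kernel of `θ`. -/
abbrev BdRPlus (p : ℕ) [Fact p.Prime] : Type := BDeRhamPlus 𝓞_ℂ_[p] p

namespace BdRPlus
variable (p : ℕ) [Fact p.Prime]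

instance algebra : Algebra ℚ_[p] (BdRPlus p) :=
  inferInstanceAs (Algebra ℚ_[p] (AdicCompletion (kerTheta p) (Binf p)))

/-- The projection `B_dR^+ → B_dR^+ / Fil^k = A_inf[1/p] / (ker θ)^k`. -/
def proj (k : ℕ) : BdRPlus p →ₐ[ℚ_[p]] Binf p ⧸ kerTheta p ^ k :=
  (AdicCompletion.evalₐ (kerTheta p) k).restrictScalars ℚ_[p]

/-- Fontaine's map `θ : B_dR^+ → ℂ_p`. -/
def theta : BdRPlus p →ₐ[ℚ_[p]] ℂ_[p] :=
  (residueEquiv p).toAlgHom.comp ((AdicCompletion.evalOneₐ (kerTheta p)).restrictScalars ℚ_[p])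

/-- The image of `p ^ n A_inf` in `B_dR^+ / Fil^k`. -/
def lattice (n k : ℕ) : AddSubgroup (Binf p ⧸ kerTheta p ^ k) :=
  (Ideal.span {(p : Ainf p) ^ n}).toAddSubgroup.map
    ((Ideal.Quotient.mk (kerTheta p ^ k)).comp (algebraMap (Ainf p) (Binf p))).toAddMonoidHom

/-- The preimage in `B_dR^+` of the image of `p ^ n A_inf` in `B_dR^+ / Fil^k`. -/
def nhdZero (i : ℕ × ℕ) : AddSubgroup (BdRPlus p) :=
  (lattice p i.1 i.2).comap (proj p i.2).toRingHom.toAddMonoidHom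

theorem mem_nhdZero (i : ℕ × ℕ) (x : BdRPlus p) : x ∈ nhdZero p i ↔ ∃ a : Ainf p,
    proj p i.2 x = Ideal.Quotient.mk _ (algebraMap (Ainf p) (Binf p) ((p : Ainf p) ^ i.1 * a)) := by
  constructor
  · rintro ⟨b, hb, h⟩
    obtain ⟨a, rfl⟩ := Ideal.mem_span_singleton.1 hb
    exact ⟨a, h.symm⟩
  · rintro ⟨a, h⟩
    exact ⟨_, Ideal.mem_span_singleton.2 ⟨a, rfl⟩, h.symm⟩

theorem factor_proj {k l : ℕ} (h : k ≤ l) (x : BdRPlus p) :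
    Ideal.Quotient.factor (Ideal.pow_le_pow_right h) (proj p l x) = proj p k x := by
  induction x using AdicCompletion.induction_on with
  | _ x =>
    change Ideal.Quotient.factor (Ideal.pow_le_pow_right h)
      (AdicCompletion.evalₐ (kerTheta p) l (AdicCompletion.mk (kerTheta p) (Binf p) x)) =
        AdicCompletion.evalₐ (kerTheta p) k (AdicCompletion.mk (kerTheta p) (Binf p) x)
    rw [AdicCompletion.evalₐ_mk, AdicCompletion.evalₐ_mk, Ideal.Quotient.factor_mk]
    have := x.2 h
    rw [SModEq.sub_mem, smul_eq_mul, Ideal.mul_top] at this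
    exact (Ideal.Quotient.eq.2 this).symm

theorem theta_apply (x : BdRPlus p) : theta p x =
    residueEquiv p (Ideal.Quotient.factor (show kerTheta p ^ 1 ≤ kerTheta p by simp) (proj p 1 x)) := by
  rfl

theorem nhdZero_anti {n m k l : ℕ} (h : n ≤ m) (h' : k ≤ l) :
    nhdZero p (m, l) ≤ nhdZero p (n, k) := by
  intro x hx
  rw [mem_nhdZero] at hx ⊢
  obtain ⟨a, ha⟩ := hx
  refine ⟨(p : Ainf p) ^ (m - n) * a, ?_⟩
  rw [← factor_proj p h', ha, ← mul_assoc, ← pow_add, Nat.add_sub_cancel' h]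
  rfl

theorem ringSubgroupsBasis : RingSubgroupsBasis (nhdZero p) := by
  refine RingSubgroupsBasis.of_comm _ ?_ ?_ ?_
  · rintro ⟨n, k⟩ ⟨m, l⟩
    exact ⟨(max n m, max k l), le_inf (nhdZero_anti p (le_max_left _ _) (le_max_left _ _))
      (nhdZero_anti p (le_max_right _ _) (le_max_right _ _))⟩
  · rintro ⟨n, k⟩
    refine ⟨(n, k), ?_⟩
    rintro _ ⟨x, hx, y, hy, rfl⟩
    rw [SetLike.mem_coe, mem_nhdZero] at hx hy ⊢
    obtain ⟨a, ha⟩ := hx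
    obtain ⟨b, hb⟩ := hy
    refine ⟨a * ((p : Ainf p) ^ n * b), ?_⟩
    rw [map_mul, ha, hb, ← map_mul, ← map_mul]
    congr 2
    ring
  · rintro x ⟨n, k⟩
    obtain ⟨b, hb⟩ := Ideal.Quotient.mk_surjective (proj p k x)
    obtain ⟨m, a, ha⟩ := IsLocalization.Away.surj (p : Ainf p) b
    refine ⟨(n + m, k), fun y hy ↦ ?_⟩
    rw [SetLike.mem_coe, mem_nhdZero] at hy
    rw [Set.mem_preimage, SetLike.mem_coe, mem_nhdZero]
    obtain ⟨c, hc⟩ := hy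
    refine ⟨a * c, ?_⟩
    rw [map_mul, hc, ← hb, ← map_mul]
    congr 1
    simp only [map_mul, ← ha, map_pow, pow_add]
    ring

/-- The canonical topology on `B_dR^+ = lim_k B_dR^+ / Fil^k`: the inverse limit of the topologies of
the `p`-adic Banach spaces `B_dR^+ / Fil^k`, whose unit ball is the image of `A_inf`. A basis of
neighbourhoods of `0` is given by the preimages of the images of `p ^ n A_inf` in `B_dR^+ / Fil^k`. -/
instance topologicalSpace : TopologicalSpace (BdRPlus p) := (ringSubgroupsBasis p).topology

variable {p}
variable {E : Type*} [Field E] [Algebra ℚ_[p] E] [FiniteDimensional ℚ_[p] E]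

theorem existsUnique_embedding (σ : E →ₐ[ℚ_[p]] ℂ_[p]) :
    ∃! ι : E →ₐ[ℚ_[p]] BdRPlus p, (theta p).comp ι = σ := by
  have : Algebra.FormallyEtale ℚ_[p] E := Algebra.FormallyEtale.of_isSeparable _ _
  obtain ⟨ι, hι⟩ : ∃ ι : E →ₐ[ℚ_[p]] BdRPlus p, ∀ x, theta p (ι x) = σ x := by
    obtain ⟨ι, hι⟩ := Algebra.FormallySmooth.exists_adicCompletionEvalOneₐ_comp_eq
      ((residueEquiv p).symm.toAlgHom.comp σ)
    refine ⟨ι, fun x ↦ ?_⟩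
    have h := AlgHom.congr_fun hι x
    change residueEquiv p (AdicCompletion.evalOneₐ (kerTheta p) (ι x)) = σ x
    change AdicCompletion.evalOneₐ (kerTheta p) (ι x) = (residueEquiv p).symm (σ x) at h
    rw [h, AlgEquiv.apply_symm_apply]
  refine ⟨ι, AlgHom.ext hι, fun ι' hι' ↦ ?_⟩
  · have key : ∀ k, (proj p k).comp ι' = (proj p k).comp ι := by
      intro k
      have hnil : IsNilpotent ((kerTheta p).map (Ideal.Quotient.mk (kerTheta p ^ k))) :=
        ⟨k, by rw [← Ideal.map_pow, Ideal.map_quotient_self, Submodule.zero_eq_bot]⟩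
      refine Algebra.FormallyUnramified.ext _ hnil fun x ↦ ?_
      rw [Ideal.Quotient.eq]
      change proj p k (ι' x) - proj p k (ι x) ∈ _
      rw [← map_sub]
      have h0 : theta p (ι' x - ι x) = 0 := by
        rw [map_sub, hι, ← hι', AlgHom.comp_apply, sub_self]
      generalize ι' x - ι x = y at h0
      rcases Nat.eq_zero_or_pos k with rfl | hk
      · have : Subsingleton (Binf p ⧸ kerTheta p ^ 0) := by
          rw [pow_zero, Ideal.one_eq_top]; infer_instance
        rw [Subsingleton.elim (proj p 0 y) 0]
        exact zero_mem _
      · rw [theta_apply, ← factor_proj p hk] at h0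
        obtain ⟨b, hb⟩ := Ideal.Quotient.mk_surjective (proj p k y)
        rw [← hb, Ideal.Quotient.factor_mk, Ideal.Quotient.factor_mk,
          EmbeddingLike.map_eq_zero_iff, Ideal.Quotient.eq_zero_iff_mem] at h0
        rw [← hb]
        exact Ideal.mem_map_of_mem _ h0
    ext x
    exact AdicCompletion.ext_evalₐ fun k ↦ AlgHom.congr_fun (key k) x

/-- A finite extension `E` of `ℚ_p` in `ℂ_p` is canonically a subfield of `B_dR^+`: this is the unique
`ℚ_p`-linear embedding of `E` in `B_dR^+` that lifts the given embedding of `E` in `ℂ_p`. -/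
def embedding (σ : E →ₐ[ℚ_[p]] ℂ_[p]) : E →ₐ[ℚ_[p]] BdRPlus p :=
  (existsUnique_embedding σ).choose

theorem theta_comp_embedding (σ : E →ₐ[ℚ_[p]] ℂ_[p]) : (theta p).comp (embedding σ) = σ :=
  (existsUnique_embedding σ).choose_spec.1

end BdRPlus

/-- The series `∑ aₙ xⁿ` converges in the topological ring `R`, where the coefficients `aₙ ∈ E` of the
power series `f` are viewed in `R` through `ι`. -/
def PowerSeries.ConvergesAt {E R : Type*} [CommRing E] [CommRing R] [TopologicalSpace R] (ι : E →+* R)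
    (f : PowerSeries E) (x : R) : Prop :=
  ∃ s : R, Filter.Tendsto (fun N : ℕ ↦ ∑ n ∈ Finset.range N, ι (PowerSeries.coeff n f) * x ^ n)
    Filter.atTop (nhds s)

end

/-!
Since `θ` is continuous, it carries a sum of `f(x)` to a sum of `f(θ(x))`. The substance is the
converse: it is enough that `σ(aₙ) θ(x)ⁿ → 0`, and a limit of `f(x)` is constructed as follows.

Assume first that `θ(x) ≠ 0`. Algebraic numbers are dense in `ℂ_p`, so there is an algebraic `α` with
`|α| = |θ(x)|`. The field `F = E(α)` is finite over `ℚ_p`, hence embeds in `B_dR^+`, and with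
`bₙ = aₙ αⁿ → 0` in `F` and `y = x / α` one has `aₙ xⁿ = bₙ yⁿ` and `|θ(y)| = 1`. The coordinates of
`bₙ` in a basis of `F` over `ℚ_p` tend to `0` because `F` is finite-dimensional, so it suffices to sum
`∑ cₙ yⁿ` for `cₙ ∈ ℚ_p` tending to `0` (`BdRPlus.seriesConverges_algebraMap_mul_pow`). For this, write
`y = û + ν` with `û ∈ A_inf` and `ν ∈ ker θ`. In
`∑ₙ cₙ yⁿ = ∑ⱼ νʲ ∑ₙ cₙ (n choose j) û ^ (n - j)` the inner sums converge because `A_inf` is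
`p`-adically complete (`BdRPlus.seriesConverges_algebraMap_mul_ofAinf`), and the outer sum because
`νʲ ∈ Fil^j` (`BdRPlus.seriesConverges_of_proj_eq_sum`).

If `θ(x) = 0`, then `xⁿ ∈ Fil^n` and the series converges for all coefficients.

As the limit is given explicitly, neither the separatedness of the topology of `B_dR^+` nor a
generator of `ker θ` plays a role.
-/

noncomputable section

open Filter Topology

/-! ### Convergent series in topological rings -/

/-- The series `∑ tₙ` converges, in the sense that its partial sums have a limit. -/
def SeriesConverges {R : Type*} [AddCommMonoid R] [TopologicalSpace R] (t : ℕ → R) : Prop :=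
  ∃ s : R, Tendsto (fun N : ℕ ↦ ∑ n ∈ Finset.range N, t n) atTop (𝓝 s)

namespace SeriesConverges

variable {R : Type*} [CommRing R] [TopologicalSpace R] [IsTopologicalRing R]

theorem const_mul {t : ℕ → R} (h : SeriesConverges t) (c : R) :
    SeriesConverges fun n ↦ c * t n := by
  obtain ⟨s, hs⟩ := h
  refine ⟨c * s, ?_⟩
  simpa only [Finset.mul_sum] using hs.const_mul c

theorem finset_sum {ι : Type*} (I : Finset ι) {t : ι → ℕ → R}
    (h : ∀ i ∈ I, SeriesConverges (t i)) : SeriesConverges fun n ↦ ∑ i ∈ I, t i n := by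
  choose! s hs using h
  refine ⟨∑ i ∈ I, s i, ?_⟩
  simp only [Finset.sum_comm (t := I)]
  exact tendsto_finsetSum I hs

theorem tendsto_zero {t : ℕ → R} (h : SeriesConverges t) : Tendsto t atTop (𝓝 0) := by
  obtain ⟨s, hs⟩ := h
  simpa [Finset.sum_range_succ] using (hs.comp (tendsto_add_atTop_nat 1)).sub hs

end SeriesConverges

/-! ### The topology of `B_dR^+` and the maps to and from it -/

theorem AdicCompletion.exists_evalₐ_eq {R : Type*} [CommRing R] (I : Ideal R) {b : ℕ → R}
    (hb : ∀ k, Ideal.Quotient.mk (I ^ k) (b k) = Ideal.Quotient.mk (I ^ k) (b (k + 1))) :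
    ∃ s : AdicCompletion I R, ∀ k, AdicCompletion.evalₐ I k s = Ideal.Quotient.mk (I ^ k) (b k) := by
  refine ⟨AdicCompletion.mk I R (AdicCompletion.AdicCauchySequence.mk I R b fun k ↦ ?_),
    fun k ↦ AdicCompletion.evalₐ_mk I k _⟩
  rw [SModEq.sub_mem, smul_eq_mul, Ideal.mul_top, ← Ideal.Quotient.eq, hb]

namespace BdRPlus

variable (p : ℕ) [Fact p.Prime]

instance isTopologicalRing : IsTopologicalRing (BdRPlus p) :=
  (ringSubgroupsBasis p).toRingFilterBasis.isTopologicalRing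

variable {p}

theorem tendsto_iff {ι : Type*} {l : Filter ι} {S : ι → BdRPlus p} {s : BdRPlus p} :
    Tendsto S l (𝓝 s) ↔ ∀ n k, ∀ᶠ i in l, S i - s ∈ nhdZero p (n, k) := by
  simp [((ringSubgroupsBasis p).hasBasis_nhds s).tendsto_right_iff]

theorem mem_nhdZero_congr {n k : ℕ} {x y : BdRPlus p} (h : proj p k x = proj p k y) :
    x ∈ nhdZero p (n, k) ↔ y ∈ nhdZero p (n, k) := by
  simp only [mem_nhdZero, h]

variable (p) in
/-- The map `A_inf → B_dR^+`. -/
def ofAinf : Ainf p →+* BdRPlus p :=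
  (algebraMap (Binf p) (AdicCompletion (kerTheta p) (Binf p))).comp (algebraMap (Ainf p) (Binf p))

theorem proj_ofAinf (k : ℕ) (a : Ainf p) :
    proj p k (ofAinf p a) = Ideal.Quotient.mk _ (algebraMap (Ainf p) (Binf p) a) :=
  (AdicCompletion.evalₐ (kerTheta p) k).commutes _

theorem theta_eq_thetaBinf {x : BdRPlus p} {b : Binf p}
    (h : proj p 1 x = Ideal.Quotient.mk _ b) : theta p x = thetaBinf p b := by
  rw [theta_apply, h]
  rfl

theorem theta_ofAinf (a : Ainf p) :
    theta p (ofAinf p a) = (WittVector.fontaineTheta 𝓞_ℂ_[p] p a : ℂ_[p]) := by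
  rw [theta_eq_thetaBinf (proj_ofAinf 1 a)]
  exact thetaBinfHom_algebraMap p a

theorem algebraMap_padicInt (x : ℤ_[p]) :
    algebraMap ℚ_[p] (BdRPlus p) x = ofAinf p (padicIntToAinf p x) := by
  change algebraMap (Binf p) (AdicCompletion (kerTheta p) (Binf p))
    (algebraMap ℚ_[p] (Binf p) x) = _
  rw [algebraMap_binf]
  rfl

theorem ofAinf_mem_nhdZero {n : ℕ} (k : ℕ) {a : Ainf p} (h : (p : Ainf p) ^ n ∣ a) :
    ofAinf p a ∈ nhdZero p (n, k) := by
  obtain ⟨b, rfl⟩ := h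
  exact (mem_nhdZero p _ _).2 ⟨b, proj_ofAinf k _⟩

theorem pow_dvd_padicIntToAinf {n : ℕ} {x : ℤ_[p]} (h : ‖x‖ ≤ (p : ℝ) ^ (-n : ℤ)) :
    (p : Ainf p) ^ n ∣ padicIntToAinf p x := by
  rw [PadicInt.norm_le_pow_iff_mem_span_pow, Ideal.mem_span_singleton] at h
  simpa using map_dvd (padicIntToAinf p) h

theorem continuous_theta : Continuous (theta p) := by
  refine continuous_of_continuousAt_zero _ ?_
  rw [ContinuousAt, map_zero, ((ringSubgroupsBasis p).hasBasis_nhds_zero).tendsto_iff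
    Metric.nhds_basis_closedBall]
  intro ε hε
  obtain ⟨n, hn⟩ := (((PadicComplexInt.tendsto_inv_pow p).eventually (gt_mem_nhds hε))).exists
  refine ⟨(n, 1), trivial, fun x hx ↦ ?_⟩
  obtain ⟨a, ha⟩ := (mem_nhdZero p _ _).1 hx
  rw [mem_closedBall_zero_iff, theta_eq_thetaBinf ha]
  refine le_trans (le_of_eq_of_le ?_ ((PadicComplexInt.norm_le_iff_dvd p n _).1
    (dvd_mul_right _ (WittVector.fontaineTheta 𝓞_ℂ_[p] p a)))) hn.le
  change ‖thetaBinfHom p _‖ = _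
  rw [thetaBinfHom_algebraMap]
  simp

instance continuousSMul : ContinuousSMul ℚ_[p] (BdRPlus p) := by
  refine continuousSMul_of_algebraMap _ _ (continuous_of_continuousAt_zero _ ?_)
  rw [ContinuousAt, map_zero, tendsto_iff]
  intro n k
  have hp : 0 < (p : ℝ) := by exact_mod_cast (Fact.out : p.Prime).pos
  filter_upwards [Metric.closedBall_mem_nhds (0 : ℚ_[p]) (zpow_pos hp (-n : ℤ))] with x hx
  rw [mem_closedBall_zero_iff] at hx
  have h1 : (p : ℝ) ^ (-n : ℤ) ≤ 1 := by
    rw [zpow_neg, zpow_natCast]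
    exact inv_le_one_of_one_le₀ (one_le_pow₀ (by exact_mod_cast (Fact.out : p.Prime).one_le))
  rw [sub_zero]
  have h2 := algebraMap_padicInt (⟨x, hx.trans h1⟩ : ℤ_[p])
  change algebraMap ℚ_[p] (BdRPlus p) x = _ at h2
  rw [h2]
  exact ofAinf_mem_nhdZero k (pow_dvd_padicIntToAinf hx)

/-! ### Convergence of series in `B_dR^+` -/

theorem proj_pow_eq_zero {x : BdRPlus p} (h : theta p x = 0) (k : ℕ) : proj p k (x ^ k) = 0 := by
  rcases Nat.eq_zero_or_pos k with rfl | hk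
  · have : Subsingleton (Binf p ⧸ kerTheta p ^ 0) := by
      rw [pow_zero, Ideal.one_eq_top]; infer_instance
    exact Subsingleton.elim _ _
  · obtain ⟨b, hb⟩ := Ideal.Quotient.mk_surjective (proj p k x)
    rw [theta_eq_thetaBinf (b := b) (by rw [← factor_proj p hk, ← hb, Ideal.Quotient.factor_mk]),
      thetaBinf_eq_zero_iff] at h
    rw [map_pow, ← hb, ← map_pow, Ideal.Quotient.eq_zero_iff_mem]
    exact Ideal.pow_mem_pow h k

theorem proj_eq_zero_of_le {k l : ℕ} (hkl : k ≤ l) {x : BdRPlus p} (h : proj p l x = 0) :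
    proj p k x = 0 := by
  rw [← factor_proj p hkl, h, map_zero]

/-- The sum of a series whose `j`-th term lies in `Fil^j`. -/
theorem exists_proj_eq_sum {v : ℕ → BdRPlus p} (hv : ∀ j, proj p j (v j) = 0) :
    ∃ s : BdRPlus p, ∀ k, proj p k s = proj p k (∑ j ∈ Finset.range k, v j) := by
  choose b hb using fun k ↦ Ideal.Quotient.mk_surjective (proj p k (∑ j ∈ Finset.range k, v j))
  obtain ⟨s, hs⟩ := AdicCompletion.exists_evalₐ_eq (kerTheta p) (b := b) fun k ↦ by
    rw [hb, ← Ideal.Quotient.factor_mk (Ideal.pow_le_pow_right k.le_succ), hb,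
      factor_proj p k.le_succ, Finset.sum_range_succ, map_add, hv, add_zero]
  exact ⟨s, fun k ↦ (hs k).trans (hb k)⟩

/-- Convergent series may be summed against a sequence `uⱼ ∈ Fil^j`: the limit is `∑ uⱼ sⱼ`, where
`sⱼ` is a limit of the `j`-th series. -/
theorem seriesConverges_of_proj_eq_sum {F : ℕ → ℕ → BdRPlus p} {u g : ℕ → BdRPlus p}
    (hu : ∀ j, proj p j (u j) = 0) (hF : ∀ j, SeriesConverges (F j))
    (hg : ∀ k n, proj p k (g n) = proj p k (∑ j ∈ Finset.range k, u j * F j n)) :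
    SeriesConverges g := by
  choose s hs using hF
  obtain ⟨S, hS⟩ := exists_proj_eq_sum (v := fun j ↦ u j * s j) fun j ↦ by
    rw [map_mul, hu, zero_mul]
  refine ⟨S, tendsto_iff.2 fun n k ↦ ?_⟩
  have h := tendsto_iff.1 (tendsto_finsetSum (Finset.range k) fun j _ ↦
    (hs j).const_mul (u j)) n k
  filter_upwards [h] with N hN
  refine (mem_nhdZero_congr ?_).1 hN
  simp only [map_sub, hS, map_sum (proj p k) _ (Finset.range N), hg, Finset.mul_sum]
  rw [Finset.sum_comm, map_sum]

/-- A series in `A_inf` whose terms tend to `0` for the `p`-adic topology has a limit. -/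
theorem exists_pow_dvd_sum_sub {u : ℕ → Ainf p} (hu : ∀ m, ∀ᶠ n in atTop, (p : Ainf p) ^ m ∣ u n) :
    ∃ s : Ainf p, ∀ m, ∀ᶠ N in atTop, (p : Ainf p) ^ m ∣ ∑ n ∈ Finset.range N, u n - s := by
  choose φ hφ using fun m ↦ eventually_atTop.1 (hu m)
  have hS : ∀ m N M, φ m ≤ N → N ≤ M →
      (p : Ainf p) ^ m ∣ ∑ n ∈ Finset.range M, u n - ∑ n ∈ Finset.range N, u n := by
    intro m N M hN hM
    rw [← Finset.sum_Ico_eq_sub _ hM]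
    exact Finset.dvd_sum fun n hn ↦ hφ m n (hN.trans (Finset.mem_Ico.1 hn).1)
  -- `ψ` is a monotone majorant of `φ`.
  let ψ : ℕ → ℕ := fun m ↦ ∑ i ∈ Finset.range (m + 1), φ i
  have hψ : Monotone ψ := fun a b hab ↦
    Finset.sum_le_sum_of_subset (Finset.range_mono (Nat.succ_le_succ hab))
  have hφψ : ∀ m, φ m ≤ ψ m := fun m ↦
    Finset.single_le_sum (f := φ) (fun _ _ ↦ Nat.zero_le _) (Finset.self_mem_range_succ m)
  obtain ⟨s, hs⟩ := IsPrecomplete.prec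
    (inferInstance : IsPrecomplete (Ideal.span {(p : Ainf p)}) (Ainf p))
    (f := fun m ↦ ∑ n ∈ Finset.range (ψ m), u n) fun {m l} hml ↦ by
      rw [SModEq.comm, SModEq.sub_mem, smul_eq_mul, Ideal.mul_top, Ideal.span_singleton_pow,
        Ideal.mem_span_singleton]
      exact hS m _ _ (hφψ m) (hψ hml)
  refine ⟨s, fun m ↦ eventually_atTop.2 ⟨ψ m, fun N hN ↦ ?_⟩⟩
  have h := hs m
  rw [SModEq.sub_mem, smul_eq_mul, Ideal.mul_top, Ideal.span_singleton_pow,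
    Ideal.mem_span_singleton] at h
  simpa using (hS m _ _ (hφψ m) hN).add h

theorem seriesConverges_ofAinf {u : ℕ → Ainf p}
    (hu : ∀ m, ∀ᶠ n in atTop, (p : Ainf p) ^ m ∣ u n) :
    SeriesConverges fun n ↦ ofAinf p (u n) := by
  obtain ⟨s, hs⟩ := exists_pow_dvd_sum_sub hu
  refine ⟨ofAinf p s, tendsto_iff.2 fun m k ↦ (hs m).mono fun N hN ↦ ?_⟩
  simpa using ofAinf_mem_nhdZero k hN

theorem seriesConverges_algebraMap_mul_ofAinf {c : ℕ → ℚ_[p]} (hc : Tendsto c atTop (𝓝 0))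
    (w : ℕ → Ainf p) : SeriesConverges fun n ↦ algebraMap ℚ_[p] (BdRPlus p) (c n) * ofAinf p (w n) := by
  have hp : 1 < (p : ℝ) := by exact_mod_cast (Fact.out : p.Prime).one_lt
  have hp0 : (p : ℚ_[p]) ≠ 0 := Nat.cast_ne_zero.2 (Fact.out : p.Prime).ne_zero
  -- A power of `p` makes all coefficients integral.
  obtain ⟨C, hC⟩ := (Metric.isBounded_range_of_tendsto c hc).exists_norm_le
  obtain ⟨M, hM⟩ := pow_unbounded_of_one_lt C hp
  have hd : ∀ n, ‖(p : ℚ_[p]) ^ M * c n‖ ≤ 1 := by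
    intro n
    rw [norm_mul, norm_pow, Padic.norm_p, inv_pow, inv_mul_le_one₀ (by positivity)]
    exact (hC _ ⟨n, rfl⟩).trans hM.le
  let d : ℕ → ℤ_[p] := fun n ↦ ⟨_, hd n⟩
  have hd0 : Tendsto (fun n ↦ ‖d n‖) atTop (𝓝 0) := by
    simpa [d] using (hc.const_mul ((p : ℚ_[p]) ^ M)).norm
  have h := seriesConverges_ofAinf (u := fun n ↦ padicIntToAinf p (d n) * w n) fun m ↦ by
    filter_upwards [hd0.eventually (ge_mem_nhds (show 0 < (p : ℝ) ^ (-m : ℤ) by positivity))]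
      with n hn
    exact (pow_dvd_padicIntToAinf hn).mul_right _
  convert h.const_mul (algebraMap ℚ_[p] (BdRPlus p) ((p : ℚ_[p]) ^ M)⁻¹) using 2 with n
  rw [map_mul, ← algebraMap_padicInt, ← mul_assoc, ← map_mul, inv_mul_cancel_left₀ (by simp [hp0])]

/-- Writing `y = û + ν` with `û ∈ A_inf` and `ν ∈ ker θ`, the `n`-th term is
`∑ⱼ νʲ • cₙ (n choose j) û ^ (n - j)`. -/
theorem seriesConverges_algebraMap_mul_pow {c : ℕ → ℚ_[p]} (hc : Tendsto c atTop (𝓝 0))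
    {y : BdRPlus p} (hy : ‖theta p y‖ ≤ 1) :
    SeriesConverges fun n ↦ algebraMap ℚ_[p] (BdRPlus p) (c n) * y ^ n := by
  obtain ⟨a, ha⟩ := surjective_fontaineTheta (R := 𝓞_ℂ_[p]) (p := p)
    (PadicComplexInt.frobenius_surjective p) ⟨_, (PadicComplexInt.norm_le_one_iff p _).2 hy⟩
  have hν : theta p (y - ofAinf p a) = 0 := by
    rw [map_sub, theta_ofAinf, ha, sub_self]
  obtain ⟨ν, rfl⟩ : ∃ ν, y = ν + ofAinf p a := ⟨y - ofAinf p a, by ring⟩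
  rw [add_sub_cancel_right] at hν
  refine seriesConverges_of_proj_eq_sum (u := fun j ↦ ν ^ j) (proj_pow_eq_zero hν)
    (fun j ↦ seriesConverges_algebraMap_mul_ofAinf hc fun n ↦ (n.choose j : Ainf p) * a ^ (n - j))
    fun k n ↦ ?_
  have hz : ∀ j, k ≤ j → proj p k (ν ^ j) = 0 := fun j hj ↦
    proj_eq_zero_of_le hj (proj_pow_eq_zero hν j)
  -- Both sides equal the sum over all `j < n + k + 1`.
  rw [add_pow, Finset.mul_sum, map_sum, map_sum,
    Finset.sum_subset (Finset.range_mono (show n + 1 ≤ n + k + 1 by omega)) fun j _ hj ↦ by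
      rw [Nat.choose_eq_zero_of_lt (by simpa using hj)]; simp,
    Finset.sum_subset (Finset.range_mono (show k ≤ n + k + 1 by omega)) fun j _ hj ↦ by
      rw [map_mul, hz j (by simpa using hj), zero_mul]]
  refine Finset.sum_congr rfl fun j _ ↦ ?_
  congr 1
  simp only [map_mul, map_pow, map_natCast]
  ring

/-! ### Series with coefficients in a finite extension -/

variable {E : Type*} [Field E] [Algebra ℚ_[p] E] [FiniteDimensional ℚ_[p] E]

theorem embedding_unique {σ : E →ₐ[ℚ_[p]] ℂ_[p]}
    {ι : E →ₐ[ℚ_[p]] BdRPlus p} (h : (theta p).comp ι = σ) : ι = embedding σ :=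
  (existsUnique_embedding σ).unique h (theta_comp_embedding σ)

theorem theta_embedding (σ : E →ₐ[ℚ_[p]] ℂ_[p]) (a : E) : theta p (embedding σ a) = σ a :=
  AlgHom.congr_fun (theta_comp_embedding σ) a

/-- Linear forms on `E` are continuous for the topology induced by `σ`, as `E` is finite-dimensional. -/
theorem tendsto_linearMap_zero (σ : E →ₐ[ℚ_[p]] ℂ_[p]) (ℓ : E →ₗ[ℚ_[p]] ℚ_[p]) {b : ℕ → E}
    (hb : Tendsto (fun n ↦ σ (b n)) atTop (𝓝 0)) : Tendsto (fun n ↦ ℓ (b n)) atTop (𝓝 0) := by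
  let e := LinearEquiv.ofInjective σ.toLinearMap σ.injective
  have hcont := LinearMap.continuous_of_finiteDimensional (ℓ ∘ₗ e.symm.toLinearMap)
  have he : Tendsto (fun n ↦ e (b n)) atTop (𝓝 0) := tendsto_subtype_rng.2 hb
  have h := (hcont.tendsto 0).comp he
  rw [map_zero] at h
  exact h.congr fun n ↦ congrArg ℓ (e.symm_apply_apply (b n))

theorem seriesConverges_embedding_mul_pow (σ : E →ₐ[ℚ_[p]] ℂ_[p]) {b : ℕ → E}
    (hb : Tendsto (fun n ↦ σ (b n)) atTop (𝓝 0)) {y : BdRPlus p} (hy : ‖theta p y‖ ≤ 1) :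
    SeriesConverges fun n ↦ embedding σ (b n) * y ^ n := by
  let B := Module.finBasis ℚ_[p] E
  have h := SeriesConverges.finset_sum Finset.univ fun i _ ↦
    (seriesConverges_algebraMap_mul_pow (tendsto_linearMap_zero σ (B.coord i) hb) hy).const_mul
      (embedding σ (B i))
  convert h using 2 with n
  conv_lhs => rw [← B.sum_repr (b n), map_sum, Finset.sum_mul]
  refine Finset.sum_congr rfl fun i _ ↦ ?_
  rw [map_smul, Algebra.smul_def, B.coord_apply]
  ring

/-- The `p`-adic absolute value takes the same values on `ℂ_p` as on the algebraic numbers. -/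
theorem exists_isIntegral_norm_eq (z : ℂ_[p]) : ∃ α : ℂ_[p], IsIntegral ℚ_[p] α ∧ ‖α‖ = ‖z‖ := by
  rcases eq_or_ne z 0 with rfl | hz
  · exact ⟨0, isIntegral_zero, rfl⟩
  obtain ⟨a, ha⟩ := UniformSpace.Completion.denseRange_coe.exists_dist_lt z (norm_pos_iff.2 hz)
  refine ⟨a, ((Algebra.IsIntegral.isIntegral (R := ℚ_[p]) a).map
    (IsScalarTower.toAlgHom ℚ_[p] (PadicAlgCl p) ℂ_[p])), ?_⟩
  rw [dist_eq_norm, sub_eq_add_neg] at ha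
  simpa using (IsUltrametricDist.norm_eq_of_add_norm_lt_max (lt_max_of_lt_left ha)).symm

theorem seriesConverges_embedding_mul_pow_of_tendsto (σ : E →ₐ[ℚ_[p]] ℂ_[p]) {a : ℕ → E}
    {x : BdRPlus p} (h : Tendsto (fun n ↦ σ (a n) * theta p x ^ n) atTop (𝓝 0)) :
    SeriesConverges fun n ↦ embedding σ (a n) * x ^ n := by
  rcases eq_or_ne (theta p x) 0 with hx | hx
  · -- Here `xⁿ ∈ Fil^n`, and the series converges whatever its coefficients are.
    refine seriesConverges_of_proj_eq_sum (u := fun j ↦ x ^ j)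
      (F := fun j n ↦ if n = j then embedding σ (a j) else 0) (proj_pow_eq_zero hx) (fun j ↦ ?_)
      fun k n ↦ ?_
    · refine ⟨embedding σ (a j), tendsto_const_nhds.congr' ?_⟩
      filter_upwards [eventually_gt_atTop j] with N hN
      simp [hN]
    · simp only [mul_ite, mul_zero, Finset.sum_ite_eq, Finset.mem_range]
      split_ifs with hn
      · rw [mul_comm]
      · rw [map_mul, proj_eq_zero_of_le (not_lt.1 hn) (proj_pow_eq_zero hx n), mul_zero, map_zero]
  · -- Replace `x` by `x / α`, of absolute value `1` in `ℂ_p`, and `E` by `E(α)`.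
    obtain ⟨α, hα, hnorm⟩ := exists_isIntegral_norm_eq (theta p x)
    have hα0 : α ≠ 0 := by rwa [← norm_ne_zero_iff, hnorm, norm_ne_zero_iff]
    have : FiniteDimensional ℚ_[p] σ.fieldRange :=
      inferInstanceAs (FiniteDimensional ℚ_[p] σ.toLinearMap.range)
    have := IntermediateField.adjoin.finiteDimensional hα
    let F := σ.fieldRange ⊔ IntermediateField.adjoin ℚ_[p] {α}
    have : FiniteDimensional ℚ_[p] F := IntermediateField.finiteDimensional_sup _ _
    let j : E →ₐ[ℚ_[p]] F :=
      (IntermediateField.inclusion le_sup_left).comp σ.rangeRestrict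
    let α' : F := ⟨α, (le_sup_right : _ ≤ F) (IntermediateField.mem_adjoin_simple_self _ α)⟩
    have hα' : α' ≠ 0 := fun h0 ↦ hα0 (congrArg Subtype.val h0)
    have hj : (embedding F.val).comp j = embedding σ := embedding_unique <| by
      rw [← AlgHom.comp_assoc, theta_comp_embedding]
      rfl
    have hy : ‖theta p (embedding F.val α'⁻¹ * x)‖ ≤ 1 := by
      rw [map_mul, theta_embedding, map_inv₀, norm_mul, norm_inv]
      change ‖α‖⁻¹ * _ ≤ 1
      rw [hnorm, inv_mul_cancel₀ (norm_ne_zero_iff.2 hx)]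
    have hb : Tendsto (fun n ↦ F.val (j (a n) * α' ^ n)) atTop (𝓝 0) := by
      rw [tendsto_zero_iff_norm_tendsto_zero] at h ⊢
      refine h.congr fun n ↦ ?_
      rw [map_mul, map_pow]
      change _ = ‖σ (a n) * α ^ n‖
      simp only [norm_mul, norm_pow, hnorm]
    convert seriesConverges_embedding_mul_pow F.val hb hy using 2 with n
    rw [← hj, map_mul, map_pow, mul_pow, AlgHom.comp_apply, mul_assoc, ← mul_assoc (_ ^ n),
      ← mul_pow, ← map_mul, mul_inv_cancel₀ hα', map_one, one_pow, one_mul]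

end BdRPlus

end

theorem mainTheorem9 (p : ℕ) [Fact p.Prime] (E : Type*) [Field E] [Algebra ℚ_[p] E]
    [FiniteDimensional ℚ_[p] E] (σ : E →ₐ[ℚ_[p]] ℂ_[p]) (f : PowerSeries E) (x : BdRPlus p) :
    f.ConvergesAt (BdRPlus.embedding σ : E →+* BdRPlus p) x ↔
      f.ConvergesAt (σ : E →+* ℂ_[p]) (BdRPlus.theta p x) := by
  constructor
  · rintro ⟨s, hs⟩
    refine ⟨BdRPlus.theta p s, ?_⟩
    convert (BdRPlus.continuous_theta.tendsto s).comp hs using 2 with N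
    simp [BdRPlus.theta_embedding]
  · -- The terms of a convergent series tend to `0`, and this is all that is needed.
    intro h
    exact BdRPlus.seriesConverges_embedding_mul_pow_of_tendsto σ (SeriesConverges.tendsto_zero h)
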